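/- Let $d \ge 1$, $s = \lceil d/2\rceil + 1$, and fix a constant $K = C_{s,d} > 0$. Let $\mathcal F^s$ be the set of all $s$ times differentiable functions $f : \mathbb R^d \to \mathbb R$ such that, for all $x \in \mathbb R^d$, $|f(x)| \le K(1+\|x\|^2)$ and $|D^\alpha f(x)| \le K(1+\|x\|^s)$ for every multi-index $\alpha$ with $|\alpha| \le s$. For $\sigma \ge 0$, a probability measure $P$ on $\mathbb R^d$ is called $\sigma^2$-subgaussian if $E_P\, e^{\|X\|^2/(2d\sigma^2)} \le 2$ (for $\sigma = 0$, with $0/0 = 0$ and $a/0 = \infty$ for $a>0$, this means $P = \delta_0$). For points $X_1,\dots,X_n \in \mathbb R^d$ put $\|f\|_{L_2(P_n)} = \big(\frac1n\sum_{i=1}^n f(X_i)^2\big)^{1/2}$, and let $N(\varepsilon,\mathcal F^s,L_2(P_n))$ be the least number of $L_2(P_n)$-balls of radius $\varepsilon$ with centres in $\mathcal F^s$ that cover $\mathcal F^s$. There is a constant $C_d > 0$, depending only on $d$ and on the constant $K$ in the definition of $\mathcal F^s$, such that the following holds for every $\sigma \ge 0$, every $\sigma^2$-subgaussian probability measure $P$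 on $\mathbb R^d$ and every $n \ge 1$. Let $X_1,\dots,X_n$ be i.i.d. with law $P$. There is a nonnegative random variable $L$, a measurable function of the sample $X_1,\dots,X_n$, with $E L \le 2$, such that almost surely: for all $\varepsilon > 0$ the number $N(\varepsilon,\mathcal F^s,L_2(P_n))$ is finite and $$\log N(\varepsilon,\mathcal F^s,L_2(P_n)) \le C_d\, L^{d/(2s)}\, \varepsilon^{-d/s}\,(1+\sigma^{2d}),$$ and $$\sup_{f\in\mathcal F^s} \|f\|^2_{L_2(P_n)} \le C_d\,(1+L\sigma^4).$$ -/

import Mathlib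

open MeasureTheory
open scoped NNReal ENNReal

noncomputable section

/-- `P` is `σ²`-subgaussian on `ℝ^d`: `E_P exp(‖X‖² / (2 d σ²)) ≤ 2`. The quotient is computed in
`[0, ∞]`, so `0 / 0 = 0` and `a / 0 = ∞` for `a > 0`; hence, for `d ≥ 1`, a probability measure is
`0`-subgaussian exactly when it is the unit mass at the origin. -/
def IsSubgaussian {d : ℕ} (P : Measure (EuclideanSpace ℝ (Fin d))) (σ : ℝ≥0) : Prop :=
  ∫⁻ x, EReal.exp ((‖x‖ₑ ^ 2 / (2 * (d : ℝ≥0∞) * (σ : ℝ≥0∞) ^ 2) : ℝ≥0∞) : EReal) ∂P ≤ 2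

/-- The partial derivative `∂_{i₁} ⋯ ∂_{iₖ} f (x)`. Every `D^α f` with `|α| = k` is of this form. -/
def partialDeriv {d k : ℕ} (i : Fin k → Fin d) (f : EuclideanSpace ℝ (Fin d) → ℝ)
    (x : EuclideanSpace ℝ (Fin d)) : ℝ :=
  iteratedFDeriv ℝ k f x (fun j => EuclideanSpace.single (i j) 1)

/-- The class `𝓕^s`, with constant `K`: the `s` times differentiable functions `f` on `ℝ^d` such
that `|f x| ≤ K (1 + ‖x‖²)` and `|D^α f x| ≤ K (1 + ‖x‖^s)` for all `|α| ≤ s`. -/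
def classF (d s : ℕ) (K : ℝ) : Set (EuclideanSpace ℝ (Fin d) → ℝ) :=
  {f | (∀ m < s, Differentiable ℝ (iteratedFDeriv ℝ m f)) ∧
    (∀ x, |f x| ≤ K * (1 + ‖x‖ ^ 2)) ∧
    ∀ k ≤ s, ∀ i : Fin k → Fin d, ∀ x, |partialDeriv i f x| ≤ K * (1 + ‖x‖ ^ s)}

/-- The seminorm `‖f‖_{L₂(P_n)} = ((1/n) ∑ᵢ f(xᵢ)²)^{1/2}` of the empirical measure `P_n` of the
points `x₁, …, xₙ`. -/
def empL2Norm {E : Type*} {n : ℕ} (x : Fin n → E) (f : E → ℝ) : ℝ :=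
  Real.sqrt ((1 / (n : ℝ)) * ∑ i, f (x i) ^ 2)

theorem empL2Norm_eq {E : Type*} {n : ℕ} (x : Fin n → E) (f : E → ℝ) :
    empL2Norm x f
      = Real.sqrt (1 / (n : ℝ)) * ‖(WithLp.toLp 2 (fun i => f (x i)) : EuclideanSpace ℝ (Fin n))‖ := by
  rw [EuclideanSpace.norm_eq, ← Real.sqrt_mul (by positivity)]
  simp [empL2Norm]

/-- The pseudometric `(f, g) ↦ ‖f - g‖_{L₂(P_n)}` on real functions. -/
abbrev empL2PseudoMetric {E : Type*} {n : ℕ} (x : Fin n → E) : PseudoMetricSpace (E → ℝ) where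
  dist f g := empL2Norm x (f - g)
  dist_self f := by simp [empL2Norm]
  dist_comm f g := by
    have h : ∀ i, (f - g) (x i) ^ 2 = (g - f) (x i) ^ 2 := fun i => by
      simp only [Pi.sub_apply]; ring
    simp only [empL2Norm, h]
  dist_triangle f g h := by
    simp only [empL2Norm_eq]
    rw [← mul_add]
    refine mul_le_mul_of_nonneg_left ?_ (Real.sqrt_nonneg _)
    refine le_trans (le_of_eq ?_) (norm_add_le _ _)
    congr 1
    ext i
    simp

/-- The covering number `N(ε, F, L₂(P_n))`: the least number of `L₂(P_n)`-balls of radius `ε`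
with centres in `F` that cover `F`. -/
def empCoveringNumber {E : Type*} {n : ℕ} (x : Fin n → E) (ε : ℝ≥0) (F : Set (E → ℝ)) : ℕ∞ :=
  @Metric.coveringNumber (E → ℝ) (empL2PseudoMetric x).toPseudoEMetricSpace ε F

end

/-! The entropy bound comes from a deterministic partition of the class in a weighted sup norm: for
`σ ≥ 1`, any two members of one part satisfy `|f x - g x| ≤ η * exp (‖x‖² / (4dσ²))` at every `x`.
Squaring doubles the exponent, so averaging over the sample gives `‖f - g‖² ≤ η² L`, where `L` is
the sample mean of `exp (‖X‖² / (2dσ²))`. Subgaussianity says exactly that `E L ≤ 2`, and `η = ε /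
√L` produces the factor `L^(d/(2s)) ε^(-d/s)`.

The partition (`exists_coloring_classF`) is built on cubes of half-side `σ` centred at `σ ℤ^d`. On
one cube, Taylor polynomials and repeated halving give the Kolmogorov entropy `(M r^s / δ)^(d/s)`
(`exists_coloring_cube_le`). On the cube at `σ z`, `M` grows polynomially in `z` while the tolerance
`δ` grows like a Gaussian, so the entropies are summable over `z`, and all but finitely many cubes
need no splitting.

Small `σ` is handled by using `max σ 1` in the entropy bound. The second bound
(`empL2Norm_classF_sq_le`) rests on the quadratic growth of `f` and `u² ≤ 2 exp u`. -/

/-! ### Taylor expansion along segments -/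

theorem abs_sub_taylor_le (s : ℕ) (φ : ℕ → ℝ → ℝ) (M : ℝ)
    (hφ : ∀ k < s, ∀ t, HasDerivAt (φ k) (φ (k + 1) t) t)
    (hM : ∀ t ∈ Set.Icc (0 : ℝ) 1, |φ s t| ≤ M) :
    ∀ t ∈ Set.Icc (0 : ℝ) 1,
      |φ 0 t - ∑ k ∈ Finset.range s, φ k 0 * (t ^ k / (k.factorial : ℝ))| ≤ M := by
  induction s generalizing φ with
  | zero => simpa using hM
  | succ s ih =>
    -- The derivative of the order `s + 1` remainder of `φ 0` is the order `s` remainder of `φ 1`;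
    -- the mean value inequality on `[0, 1]` then transfers the bound. Continuity of the top
    -- derivative is never needed, and the factor `1 / s!` is given up.
    have ih' := ih (fun k => φ (k + 1)) (fun k hk => hφ (k + 1) (by omega)) hM
    have hderiv : ∀ t, HasDerivAt
        (fun t => φ 0 t - ∑ k ∈ Finset.range (s + 1), φ k 0 * (t ^ k / (k.factorial : ℝ)))
        (φ 1 t - ∑ k ∈ Finset.range s, φ (k + 1) 0 * (t ^ k / (k.factorial : ℝ))) t := by
      intro t
      refine (hφ 0 (by omega) t).sub ?_
      simp only [Finset.sum_range_succ']
      have h0 : ∀ k, HasDerivAt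
          (fun t : ℝ => φ (k + 1) 0 * (t ^ (k + 1) / ((k + 1).factorial : ℝ)))
          (φ (k + 1) 0 * (t ^ k / (k.factorial : ℝ))) t := by
        intro k
        have := ((hasDerivAt_pow (k + 1) t).div_const ((k + 1).factorial : ℝ)).const_mul
          (φ (k + 1) 0)
        refine this.congr_deriv ?_
        rw [Nat.factorial_succ, Nat.add_sub_cancel]
        push_cast
        have : (k.factorial : ℝ) ≠ 0 := by positivity
        have : (k : ℝ) + 1 ≠ 0 := by positivity
        field_simp
      have := (HasDerivAt.fun_sum (u := Finset.range s) fun k _ => h0 k)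
      simpa using this
    intro t ht
    have hbd := (convex_Icc (0 : ℝ) 1).norm_image_sub_le_of_norm_hasDerivWithin_le
      (fun x _ => (hderiv x).hasDerivWithinAt) (fun x hx => ih' x hx)
      (Set.left_mem_Icc.2 zero_le_one) ht
    have hM0 : 0 ≤ M := (abs_nonneg _).trans (ih' 0 (Set.left_mem_Icc.2 zero_le_one))
    have h00 : φ 0 0 - ∑ k ∈ Finset.range (s + 1), φ k 0 * ((0 : ℝ) ^ k / (k.factorial : ℝ)) = 0 := by
      simp [Finset.sum_range_succ']
    simp only [h00, sub_zero, Real.norm_eq_abs] at hbd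
    refine hbd.trans ?_
    rw [abs_of_nonneg ht.1]
    exact mul_le_of_le_one_right hM0 ht.2

theorem iteratedFDeriv_diag_eq_sum {d k : ℕ} (f : EuclideanSpace ℝ (Fin d) → ℝ)
    (x u : EuclideanSpace ℝ (Fin d)) :
    iteratedFDeriv ℝ k f x (fun _ => u)
      = ∑ i : Fin k → Fin d, (∏ j, u (i j)) * partialDeriv i f x := by
  have hu : u = ∑ i, u i • EuclideanSpace.single i (1 : ℝ) := by
    ext j
    simp [Finset.sum_apply, Pi.single_apply]
  conv_lhs => rw [hu]
  rw [ContinuousMultilinearMap.map_sum]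
  refine Finset.sum_congr rfl fun i _ => ?_
  rw [ContinuousMultilinearMap.map_smul_univ]
  simp [partialDeriv]

theorem hasDerivAt_iteratedFDeriv_line {d k : ℕ} {f : EuclideanSpace ℝ (Fin d) → ℝ}
    (hf : Differentiable ℝ (iteratedFDeriv ℝ k f)) (c u : EuclideanSpace ℝ (Fin d)) (t : ℝ) :
    HasDerivAt (fun t : ℝ => iteratedFDeriv ℝ k f (c + t • u) (fun _ => u))
      (iteratedFDeriv ℝ (k + 1) f (c + t • u) (fun _ => u)) t := by
  have hl : HasDerivAt (fun t : ℝ => c + t • u) u t := by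
    simpa using ((hasDerivAt_id t).smul_const u).const_add c
  have h1 := (hf (c + t • u)).hasFDerivAt.comp_hasDerivAt t hl
  have h2 := (ContinuousMultilinearMap.apply ℝ (fun _ : Fin k => EuclideanSpace ℝ (Fin d)) ℝ
    (fun _ => u)).hasFDerivAt.comp_hasDerivAt t h1
  rw [iteratedFDeriv_succ_apply_left]
  exact h2

/-- The closed cube with centre `c` and half-side `r`. -/
def cube {d : ℕ} (c : EuclideanSpace ℝ (Fin d)) (r : ℝ) : Set (EuclideanSpace ℝ (Fin d)) :=
  {x | ∀ i, |x i - c i| ≤ r}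

theorem abs_sub_taylorPoly_le {d s : ℕ} {f : EuclideanSpace ℝ (Fin d) → ℝ}
    (hf : ∀ m < s, Differentiable ℝ (iteratedFDeriv ℝ m f))
    {c : EuclideanSpace ℝ (Fin d)} {r M : ℝ} (hr : 0 ≤ r)
    (hM : ∀ i : Fin s → Fin d, ∀ y ∈ cube c r, |partialDeriv i f y| ≤ M)
    {v : Fin d → ℝ} (hv : ∀ i, |v i| ≤ 1) :
    |f (c + r • WithLp.toLp 2 v) - ∑ k ∈ Finset.range s, ∑ i : Fin k → Fin d,
      (r ^ k / (k.factorial : ℝ) * partialDeriv i f c) * ∏ j, v (i j)|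
      ≤ (d : ℝ) ^ s * M * r ^ s := by
  set u : EuclideanSpace ℝ (Fin d) := r • WithLp.toLp 2 v with hu
  have hui : ∀ i, u i = r * v i := fun i => by simp [hu]
  have hprod : ∀ {k : ℕ} (i : Fin k → Fin d), ∏ j, u (i j) = r ^ k * ∏ j, v (i j) := by
    intro k i
    simp [hui, Finset.prod_mul_distrib]
  have key := abs_sub_taylor_le s
    (fun k t => iteratedFDeriv ℝ k f (c + t • u) (fun _ => u)) ((d : ℝ) ^ s * M * r ^ s)
    (fun k hk t => hasDerivAt_iteratedFDeriv_line (hf k hk) c u t) ?_ 1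
    (Set.right_mem_Icc.2 zero_le_one)
  · convert key using 3
    · simp
    · refine Finset.sum_congr rfl fun k _ => ?_
      rw [iteratedFDeriv_diag_eq_sum, Finset.sum_mul]
      refine Finset.sum_congr rfl fun i _ => ?_
      rw [hprod]
      simp
      ring
  · intro t ht
    have hy : c + t • u ∈ cube c r := by
      intro i
      simp only [PiLp.add_apply, PiLp.smul_apply, hui, smul_eq_mul, add_sub_cancel_left, abs_mul,
        abs_of_nonneg ht.1, abs_of_nonneg hr]
      have := mul_le_mul ht.2 (mul_le_of_le_one_right hr (hv i)) (by positivity) zero_le_one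
      simpa using this
    rw [iteratedFDeriv_diag_eq_sum]
    refine (Finset.abs_sum_le_sum_abs _ _).trans ?_
    have hterm : ∀ i ∈ (Finset.univ : Finset (Fin s → Fin d)),
        |(∏ j, u (i j)) * partialDeriv i f (c + t • u)| ≤ r ^ s * M := by
      intro i _
      rw [abs_mul, hprod, abs_mul, abs_of_nonneg (pow_nonneg hr s), Finset.abs_prod]
      refine mul_le_mul ?_ (hM i _ hy) (abs_nonneg _) (by positivity)
      exact mul_le_of_le_one_right (by positivity)
        (Finset.prod_le_one (fun _ _ => abs_nonneg _) fun j _ => hv _)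
    refine (Finset.sum_le_card_nsmul _ _ _ hterm).trans (le_of_eq ?_)
    simp
    ring

/-! ### Colourings: partitions that multiply under intersection and refinement -/

/-- `H` splits into `m` colour classes, within each of which `R` holds between any two members. -/
def HasColoring {X : Type*} (m : ℕ) (H : Set X) (R : X → X → Prop) : Prop :=
  ∃ φ : X → Fin m, ∀ f ∈ H, ∀ g ∈ H, φ f = φ g → R f g

theorem HasColoring.of_fintype {X ι : Type*} [Fintype ι] {m : ℕ} {H : Set X}
    {R : X → X → Prop} (hm : Fintype.card ι ≤ m) (φ : X → ι)
    (h : ∀ f ∈ H, ∀ g ∈ H, φ f = φ g → R f g) : HasColoring m H R := by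
  refine ⟨fun f => Fin.castLE hm (Fintype.equivFin ι (φ f)), fun f hf g hg hfg => h f hf g hg ?_⟩
  simpa using hfg

theorem HasColoring.one {X : Type*} {H : Set X} {R : X → X → Prop}
    (h : ∀ f ∈ H, ∀ g ∈ H, R f g) : HasColoring 1 H R :=
  ⟨fun _ => 0, fun f hf g hg _ => h f hf g hg⟩

theorem HasColoring.mono {X : Type*} {m m' : ℕ} {H : Set X} {R R' : X → X → Prop}
    (h : HasColoring m H R) (hm : m ≤ m') (hR : ∀ f ∈ H, ∀ g ∈ H, R f g → R' f g) :
    HasColoring m' H R' := by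
  obtain ⟨φ, hφ⟩ := h
  exact .of_fintype (by simpa using hm) φ fun f hf g hg e => hR f hf g hg (hφ f hf g hg e)

theorem HasColoring.prod {X ι : Type*} {S : Finset ι} {m : ι → ℕ} {H : Set X}
    {R : ι → X → X → Prop} (h : ∀ i ∈ S, HasColoring (m i) H (R i)) :
    HasColoring (∏ i ∈ S, m i) H (fun f g => ∀ i ∈ S, R i f g) := by
  classical
  choose φ hφ using h
  refine .of_fintype (ι := ∀ i : S, Fin (m i)) ?_ (fun f i => φ i i.2 f) ?_
  · rw [Fintype.card_pi]
    simp only [Fintype.card_fin]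
    rw [Finset.prod_coe_sort S m]
  · intro f hf g hg e i hi
    exact hφ i hi f hf g hg (congrFun e ⟨i, hi⟩)

/-- Each colour class is coloured separately, and the pair of colours is recorded. -/
theorem HasColoring.refine {X : Type*} {m m' : ℕ} {H : Set X} {R R' : X → X → Prop}
    (h : HasColoring m H R)
    (h' : ∀ H' ⊆ H, (∀ f ∈ H', ∀ g ∈ H', R f g) → HasColoring m' H' R') :
    HasColoring (m * m') H R' := by
  obtain ⟨φ, hφ⟩ := h
  have h2 : ∀ a : Fin m, HasColoring m' {f ∈ H | φ f = a} R' := fun a =>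
    h' _ (Set.sep_subset _ _) fun f hf g hg => hφ f hf.1 g hg.1 (hf.2.trans hg.2.symm)
  choose ψ hψ using h2
  refine .of_fintype (ι := Fin m × Fin m') (by simp) (fun f => (φ f, ψ (φ f) f)) ?_
  intro f hf g hg e
  obtain ⟨e1, e2⟩ := Prod.mk.inj e
  refine hψ (φ f) f ⟨hf, rfl⟩ g ⟨hg, e1.symm⟩ ?_
  rw [e2, e1]

/-! ### Polynomials on the unit cube -/

/-- The monomial `v ↦ ∏ⱼ v (i j)` on the cube `[-1, 1]^d`. -/
def cubeMonomial {d k : ℕ} (i : Fin k → Fin d) : C(Fin d → Set.Icc (-1 : ℝ) 1, ℝ) where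
  toFun v := ∏ j, (v (i j) : ℝ)
  continuous_toFun := by fun_prop

/-- The polynomials of degree less than `s` on the cube `[-1, 1]^d`. -/
def cubePoly (d s : ℕ) : Submodule ℝ C(Fin d → Set.Icc (-1 : ℝ) 1, ℝ) :=
  Submodule.span ℝ (Set.range fun p : (Σ k : Fin s, Fin k → Fin d) => cubeMonomial p.2)

instance finiteDimensional_cubePoly (d s : ℕ) : FiniteDimensional ℝ (cubePoly d s) :=
  FiniteDimensional.span_of_finite ℝ (Set.finite_range _)

theorem exists_cubePoly_approx {d s : ℕ} {f : EuclideanSpace ℝ (Fin d) → ℝ}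
    (hf : ∀ m < s, Differentiable ℝ (iteratedFDeriv ℝ m f))
    {c : EuclideanSpace ℝ (Fin d)} {r M : ℝ} (hr : 0 ≤ r)
    (hM : ∀ i : Fin s → Fin d, ∀ y ∈ cube c r, |partialDeriv i f y| ≤ M) :
    ∃ p ∈ cubePoly d s, ∀ v : Fin d → Set.Icc (-1 : ℝ) 1,
      |f (c + r • WithLp.toLp 2 (fun i => (v i : ℝ))) - p v| ≤ (d : ℝ) ^ s * M * r ^ s := by
  refine ⟨∑ k : Fin s, ∑ i : Fin k → Fin d,
    (r ^ (k : ℕ) / ((k : ℕ).factorial : ℝ) * partialDeriv i f c) • cubeMonomial i, ?_, ?_⟩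
  · refine Submodule.sum_mem _ fun k _ => Submodule.sum_mem _ fun i _ => ?_
    exact Submodule.smul_mem _ _ (Submodule.subset_span ⟨⟨k, i⟩, rfl⟩)
  · intro v
    have := abs_sub_taylorPoly_le hf hr hM (v := fun i => (v i : ℝ))
      (fun i => abs_le.2 (v i).2)
    rw [← Fin.sum_univ_eq_sum_range (fun k => ∑ i : Fin k → Fin d,
      (r ^ k / (k.factorial : ℝ) * partialDeriv i f c) * ∏ j, (v (i j) : ℝ))] at this
    convert this using 3
    simp [ContinuousMap.sum_apply, cubeMonomial]

theorem totallyBounded_cubePoly (d s : ℕ) (R : ℝ) :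
    TotallyBounded {p : C(Fin d → Set.Icc (-1 : ℝ) 1, ℝ) | p ∈ cubePoly d s ∧ ‖p‖ ≤ R} := by
  have hc := ((isCompact_closedBall (0 : cubePoly d s) R).image
    continuous_subtype_val).totallyBounded
  refine hc.subset ?_
  rintro p ⟨hp, hpR⟩
  exact ⟨⟨p, hp⟩, mem_closedBall_zero_iff.2 hpR, rfl⟩

/-- Bounded sets in a finite-dimensional space are totally bounded: colouring by a point of a 1-net
makes equal colours at most 2 apart. After rescaling, this single `N` serves every cube and every
scale. -/
theorem exists_coloring_cubePoly (d s : ℕ) (R : ℝ) (hR : 0 ≤ R) :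
    ∃ N : ℕ, 0 < N ∧ HasColoring N
      {p : C(Fin d → Set.Icc (-1 : ℝ) 1, ℝ) | p ∈ cubePoly d s ∧ ∀ v, |p v| ≤ R}
      (fun p q => ∀ v, |p v - q v| ≤ 2) := by
  classical
  obtain ⟨t, htf, ht⟩ := Metric.totallyBounded_iff.1 (totallyBounded_cubePoly d s R) 1 one_pos
  have : ∀ p : C(Fin d → Set.Icc (-1 : ℝ) 1, ℝ), ∃ o : Option htf.toFinset,
      (p ∈ cubePoly d s ∧ ∀ v, |p v| ≤ R) →
        ∃ q, o = some q ∧ dist p (q : C(Fin d → Set.Icc (-1 : ℝ) 1, ℝ)) < 1 := by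
    intro p
    by_cases hp : p ∈ cubePoly d s ∧ ∀ v, |p v| ≤ R
    · obtain ⟨q, hq, hpq⟩ := Set.mem_iUnion₂.1 (ht ⟨hp.1, (ContinuousMap.norm_le _ hR).2 hp.2⟩)
      exact ⟨some ⟨q, htf.mem_toFinset.2 hq⟩, fun _ => ⟨_, rfl, hpq⟩⟩
    · exact ⟨none, fun h => absurd h hp⟩
  choose φ hφ using this
  refine ⟨Fintype.card (Option htf.toFinset), Fintype.card_pos_iff.2 ⟨none⟩,
    .of_fintype le_rfl φ ?_⟩
  intro p hp q hq e v
  obtain ⟨a, ha, hpa⟩ := hφ p hp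
  obtain ⟨b, hb, hqb⟩ := hφ q hq
  have hab : a = b := by
    rw [ha, hb] at e
    exact Option.some.inj e
  subst hab
  have h1 := ContinuousMap.dist_apply_le_dist (f := p) (g := q) v
  have h2 := dist_triangle_right p q (a : C(Fin d → Set.Icc (-1 : ℝ) 1, ℝ))
  rw [Real.dist_eq] at h1
  linarith

/-! ### Multiscale colouring on one cube -/

/-- The functions with `s` derivatives whose partial derivatives of order `s` are at most `M`
on `Q`. -/
def smoothOn {d : ℕ} (s : ℕ) (M : ℝ) (Q : Set (EuclideanSpace ℝ (Fin d))) :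
    Set (EuclideanSpace ℝ (Fin d) → ℝ) :=
  {f | (∀ m < s, Differentiable ℝ (iteratedFDeriv ℝ m f)) ∧
    ∀ i : Fin s → Fin d, ∀ y ∈ Q, |partialDeriv i f y| ≤ M}

/-- The ratio, in units of `M * r ^ s`, at which the class can be refined to the next scale. -/
def scaleConst (d s : ℕ) : ℝ := 2 ^ s * (2 + 4 * (d : ℝ) ^ s)

/-- In units of `M * r ^ s`, the Taylor polynomials differ from that of a fixed `g₀` by a bounded
amount, so `N` colours bring them within 2 of each other. Adding the two Taylor errors keeps `f - g`
within `2 + 4 * d ^ s`, which is `scaleConst` at the halved radius. -/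
theorem exists_coloring_cube_step (d s : ℕ) :
    ∃ N : ℕ, 0 < N ∧ ∀ (M r : ℝ) (c : EuclideanSpace ℝ (Fin d))
      (H : Set (EuclideanSpace ℝ (Fin d) → ℝ)), 0 < M → 0 < r → H ⊆ smoothOn s M (cube c r) →
      (∀ f ∈ H, ∀ g ∈ H, ∀ x ∈ cube c r, |f x - g x| ≤ scaleConst d s * (M * r ^ s)) →
      HasColoring N H (fun f g => ∀ x ∈ cube c r,
        |f x - g x| ≤ scaleConst d s * (M * (r / 2) ^ s)) := by
  classical
  obtain ⟨N, hN, hcol⟩ := exists_coloring_cubePoly d s (scaleConst d s + 2 * (d : ℝ) ^ s)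
    (by unfold scaleConst; positivity)
  refine ⟨N, hN, fun M r c H hM hr hH hdiam => ?_⟩
  rcases H.eq_empty_or_nonempty with rfl | ⟨g₀, hg₀⟩
  · exact ⟨fun _ => ⟨0, hN⟩, fun f hf => absurd hf (Set.notMem_empty f)⟩
  have hMr : 0 < M * r ^ s := by positivity
  have happ : ∀ f, ∃ p : C(Fin d → Set.Icc (-1 : ℝ) 1, ℝ), f ∈ H → p ∈ cubePoly d s ∧
      ∀ v : Fin d → Set.Icc (-1 : ℝ) 1,
        |f (c + r • WithLp.toLp 2 (fun i => (v i : ℝ))) - p v| ≤ (d : ℝ) ^ s * M * r ^ s := by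
    intro f
    by_cases hf : f ∈ H
    · obtain ⟨p, hp, h⟩ := exists_cubePoly_approx (hH hf).1 hr.le (hH hf).2
      exact ⟨p, fun _ => ⟨hp, h⟩⟩
    · exact ⟨0, fun h => absurd h hf⟩
  choose p hp using happ
  have hmem : ∀ v : Fin d → Set.Icc (-1 : ℝ) 1,
      c + r • WithLp.toLp 2 (fun i => (v i : ℝ)) ∈ cube c r := by
    intro v i
    simp only [PiLp.add_apply, PiLp.smul_apply, smul_eq_mul, add_sub_cancel_left, abs_mul,
      abs_of_pos hr]
    exact mul_le_of_le_one_right hr.le (abs_le.2 (v i).2)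
  obtain ⟨φ, hφ⟩ := hcol
  refine ⟨fun f => φ ((M * r ^ s)⁻¹ • (p f - p g₀)), fun f hf g hg e x hx => ?_⟩
  have hball : ∀ f ∈ H, (M * r ^ s)⁻¹ • (p f - p g₀) ∈ cubePoly d s ∧
      ∀ v, |((M * r ^ s)⁻¹ • (p f - p g₀)) v| ≤ scaleConst d s + 2 * (d : ℝ) ^ s := by
    intro f hf
    refine ⟨Submodule.smul_mem _ _ (Submodule.sub_mem _ (hp f hf).1 (hp g₀ hg₀).1), fun v => ?_⟩
    have h1 := abs_le.1 ((hp f hf).2 v)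
    have h2 := abs_le.1 ((hp g₀ hg₀).2 v)
    have h3 := abs_le.1 (hdiam f hf g₀ hg₀ _ (hmem v))
    rw [ContinuousMap.smul_apply, smul_eq_mul, abs_mul, abs_inv, abs_of_pos hMr,
      inv_mul_le_iff₀ hMr, ContinuousMap.sub_apply, abs_le]
    constructor <;> nlinarith
  have hv : ∀ i, (x i - c i) / r ∈ Set.Icc (-1 : ℝ) 1 := by
    intro i
    rw [Set.mem_Icc, ← abs_le, abs_div, abs_of_pos hr, div_le_one hr]
    exact hx i
  have hxv : x = c + r • WithLp.toLp 2 (fun i => (((⟨_, hv i⟩ : Set.Icc (-1 : ℝ) 1)) : ℝ)) := by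
    ext i
    simp
    field_simp
    ring
  have h1 := abs_le.1 ((hp f hf).2 fun i => ⟨_, hv i⟩)
  have h2 := abs_le.1 ((hp g hg).2 fun i => ⟨_, hv i⟩)
  rw [← hxv] at h1 h2
  have h3 := hφ _ (hball f hf) _ (hball g hg) e fun i => ⟨_, hv i⟩
  rw [ContinuousMap.smul_apply, ContinuousMap.smul_apply, ← smul_sub, smul_eq_mul, abs_mul,
    abs_inv, abs_of_pos hMr, inv_mul_le_iff₀ hMr, ContinuousMap.sub_apply, ContinuousMap.sub_apply,
    sub_sub_sub_cancel_right, abs_le] at h3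
  have h4 : scaleConst d s * (M * (r / 2) ^ s) = (2 + 4 * (d : ℝ) ^ s) * (M * r ^ s) := by
    unfold scaleConst
    rw [div_pow]
    field_simp
  rw [h4, abs_le]
  constructor <;> nlinarith

theorem cube_half_subset {d : ℕ} {c : EuclideanSpace ℝ (Fin d)} {r : ℝ} (b : Fin d → Bool) :
    cube (c + (r / 2) • WithLp.toLp 2 (fun i => if b i then (1 : ℝ) else -1)) (r / 2)
      ⊆ cube c r := by
  intro x hx i
  have h := abs_le.1 (hx i)
  simp only [PiLp.add_apply, PiLp.smul_apply, smul_eq_mul] at h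
  rw [abs_le]
  split_ifs at h <;> constructor <;> linarith

theorem exists_mem_cube_half {d : ℕ} {c x : EuclideanSpace ℝ (Fin d)} {r : ℝ} (hx : x ∈ cube c r) :
    ∃ b : Fin d → Bool,
      x ∈ cube (c + (r / 2) • WithLp.toLp 2 (fun i => if b i then (1 : ℝ) else -1)) (r / 2) := by
  refine ⟨fun i => decide (c i ≤ x i), fun i => ?_⟩
  have h := abs_le.1 (hx i)
  simp only [PiLp.add_apply, PiLp.smul_apply, smul_eq_mul, decide_eq_true_eq]
  rw [abs_le]
  split_ifs with hc <;> constructor <;> linarith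

theorem exists_coloring_cube (d s : ℕ) (hd : 1 ≤ d) :
    ∃ N : ℕ, 0 < N ∧ ∀ (k : ℕ) (M r : ℝ) (c : EuclideanSpace ℝ (Fin d))
      (H : Set (EuclideanSpace ℝ (Fin d) → ℝ)), 0 < M → 0 < r → H ⊆ smoothOn s M (cube c r) →
      (∀ f ∈ H, ∀ g ∈ H, ∀ x ∈ cube c r, |f x - g x| ≤ scaleConst d s * (M * r ^ s)) →
      HasColoring (N ^ (2 ^ (d * k) - 1)) H (fun f g => ∀ x ∈ cube c r,
        |f x - g x| ≤ scaleConst d s * (M * (r / 2 ^ k) ^ s)) := by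
  obtain ⟨N, hN, hstep⟩ := exists_coloring_cube_step d s
  refine ⟨N, hN, fun k => ?_⟩
  induction k with
  | zero =>
    intro M r c H hM hr hH hdiam
    simpa using HasColoring.one hdiam
  | succ k ih =>
    intro M r c H hM hr hH hdiam
    have hcol := (hstep M r c H hM hr hH hdiam).refine (m' := ∏ _b : Fin d → Bool, N ^ (2 ^ (d * k) - 1))
      (R' := fun f g => ∀ b ∈ (Finset.univ : Finset (Fin d → Bool)),
        ∀ x ∈ cube (c + (r / 2) • WithLp.toLp 2 (fun i => if b i then (1 : ℝ) else -1)) (r / 2),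
          |f x - g x| ≤ scaleConst d s * (M * (r / 2 / 2 ^ k) ^ s)) ?_
    · refine hcol.mono ?_ ?_
      -- The exponent `2 ^ (d * k) - 1` closes the recursion: `1 + 2^d (2^(dk) - 1) ≤ 2^(d(k+1)) -
      -- 1` because `2^d ≥ 2`. The costs of the scales add geometrically, so no logarithmic factor
      -- appears.
      · rw [Finset.prod_const, ← pow_mul, ← pow_succ']
        refine Nat.pow_le_pow_right hN ?_
        have h1 : 2 ^ (d * (k + 1)) = 2 ^ (d * k) * 2 ^ d := by rw [mul_add, pow_add, mul_one]
        have h2 : 2 ≤ 2 ^ d := by simpa using Nat.pow_le_pow_right (n := 2) (by norm_num) hd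
        have h3 : (2 ^ (d * k) - 1) * 2 ^ d = 2 ^ (d * k) * 2 ^ d - 2 ^ d := by
          rw [Nat.sub_mul, one_mul]
        have h4 : 2 ^ d ≤ 2 ^ (d * k) * 2 ^ d := Nat.le_mul_of_pos_left _ (by positivity)
        simp only [Finset.card_univ, Fintype.card_pi, Fintype.card_bool, Finset.prod_const,
          Fintype.card_fin]
        omega
      · intro f _ g _ h x hx
        obtain ⟨b, hb⟩ := exists_mem_cube_half hx
        have := h b (Finset.mem_univ b) x hb
        rwa [div_div, ← pow_succ'] at this
    · intro H' hH' hdiam'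
      refine HasColoring.prod fun b _ => ih M (r / 2) _ H' hM (by positivity) ?_ ?_
      · exact fun f hf => ⟨(hH (hH' hf)).1, fun i y hy => (hH (hH' hf)).2 i y (cube_half_subset b hy)⟩
      · exact fun f hf g hg x hx => hdiam' f hf g hg x (cube_half_subset b hx)

theorem exists_coloring_cube_le (d s : ℕ) (hd : 1 ≤ d) (hs : 1 ≤ s) :
    ∃ A : ℝ, 0 < A ∧ ∀ (M r δ : ℝ) (c : EuclideanSpace ℝ (Fin d))
      (H : Set (EuclideanSpace ℝ (Fin d) → ℝ)), 0 < M → 0 < r → 0 < δ →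
      H ⊆ smoothOn s M (cube c r) →
      (∀ f ∈ H, ∀ g ∈ H, ∀ x ∈ cube c r, |f x - g x| ≤ scaleConst d s * (M * r ^ s)) →
      ∃ m : ℕ, 0 < m ∧ HasColoring m H (fun f g => ∀ x ∈ cube c r, |f x - g x| ≤ δ) ∧
        Real.log m ≤ A * (M * r ^ s / δ) ^ ((d : ℝ) / s) ∧
        (scaleConst d s * (M * r ^ s) ≤ δ → m = 1) := by
  obtain ⟨N, hN, hcol⟩ := exists_coloring_cube d s hd
  have hB : 0 < scaleConst d s := by unfold scaleConst; positivity
  have hlogN : 0 ≤ Real.log N := Real.log_natCast_nonneg N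
  refine ⟨2 ^ d * Real.log N * scaleConst d s ^ ((d : ℝ) / s) + 1, by positivity, ?_⟩
  intro M r δ c H hM hr hδ hH hdiam
  have hMr : 0 < M * r ^ s := by positivity
  by_cases hsmall : scaleConst d s * (M * r ^ s) ≤ δ
  · refine ⟨1, one_pos, .one fun f hf g hg x hx => (hdiam f hf g hg x hx).trans hsmall, ?_,
      fun _ => rfl⟩
    simp only [Nat.cast_one, Real.log_one]
    positivity
  set a : ℝ := scaleConst d s * (M * r ^ s) / δ with ha
  have ha1 : 1 ≤ a := by
    rw [ha, one_le_div hδ]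
    exact (not_le.1 hsmall).le
  have ha0 : 0 ≤ a := zero_le_one.trans ha1
  have hs0 : (s : ℝ) ≠ 0 := by positivity
  -- The number of halvings is `n + 1` with `2^n ≤ a^(1/s) < 2^(n+1)`: enough to reach `δ`, and
  -- overshooting by at most a factor 2.
  obtain ⟨n, hn1, hn2⟩ := exists_nat_pow_near
    (Real.one_le_rpow ha1 (by positivity : 0 ≤ 1 / (s : ℝ))) (one_lt_two (α := ℝ))
  have hts : (a ^ (1 / (s : ℝ))) ^ s = a := by
    rw [← Real.rpow_natCast, ← Real.rpow_mul ha0, one_div_mul_cancel hs0, Real.rpow_one]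
  refine ⟨N ^ (2 ^ (d * (n + 1)) - 1), pow_pos hN _,
    (hcol (n + 1) M r c H hM hr hH hdiam).mono le_rfl ?_, ?_, fun h => absurd h hsmall⟩
  · intro f _ g _ h x hx
    refine (h x hx).trans ?_
    have h1 : a ≤ (2 ^ (n + 1) : ℝ) ^ s := by
      rw [← hts]
      exact pow_le_pow_left₀ (by positivity) hn2.le s
    rw [ha, div_le_iff₀ hδ] at h1
    rw [div_pow, ← mul_div_assoc, ← mul_div_assoc, div_le_iff₀ (by positivity)]
    linarith
  · have h2 : ((2 ^ (d * (n + 1)) - 1 : ℕ) : ℝ) ≤ 2 ^ d * a ^ ((d : ℝ) / s) := by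
      calc ((2 ^ (d * (n + 1)) - 1 : ℕ) : ℝ) ≤ ((2 ^ (d * (n + 1)) : ℕ) : ℝ) := by
            exact_mod_cast Nat.sub_le _ _
        _ = (2 * 2 ^ n) ^ d := by
            push_cast
            rw [← pow_succ', ← pow_mul, mul_comm d]
        _ ≤ (2 * a ^ (1 / (s : ℝ))) ^ d := by gcongr
        _ = 2 ^ d * a ^ ((d : ℝ) / s) := by
            rw [mul_pow, ← Real.rpow_natCast (a ^ (1 / (s : ℝ))), ← Real.rpow_mul ha0]
            congr 2
            ring
    have h3 : a ^ ((d : ℝ) / s)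
        = scaleConst d s ^ ((d : ℝ) / s) * (M * r ^ s / δ) ^ ((d : ℝ) / s) := by
      rw [← Real.mul_rpow hB.le (by positivity), ha, mul_div_assoc]
    have h4 : 0 ≤ (M * r ^ s / δ) ^ ((d : ℝ) / s) := by positivity
    rw [Nat.cast_pow, Real.log_pow]
    calc ((2 ^ (d * (n + 1)) - 1 : ℕ) : ℝ) * Real.log N
        ≤ 2 ^ d * a ^ ((d : ℝ) / s) * Real.log N := by gcongr
      _ = 2 ^ d * Real.log N * scaleConst d s ^ ((d : ℝ) / s)
          * (M * r ^ s / δ) ^ ((d : ℝ) / s) := by rw [h3]; ring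
      _ ≤ _ := by nlinarith

/-! ### Summation over the lattice of cubes -/

/-- A finite `S` lies in the box of its coordinate projections, over which the sum factorizes. -/
theorem sum_prod_le_tsum_pow {ι κ : Type*} [Fintype ι] {q : κ → ℝ} (hq0 : ∀ m, 0 ≤ q m)
    (hq : Summable q) (S : Finset (ι → κ)) :
    ∑ z ∈ S, ∏ i, q (z i) ≤ (∑' m, q m) ^ Fintype.card ι := by
  classical
  calc ∑ z ∈ S, ∏ i, q (z i)
      ≤ ∑ z ∈ Fintype.piFinset (fun i => S.image (fun z => z i)), ∏ i, q (z i) := by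
        refine Finset.sum_le_sum_of_subset_of_nonneg ?_ fun z _ _ =>
          Finset.prod_nonneg fun i _ => hq0 _
        intro z hz
        exact Fintype.mem_piFinset.2 fun i => Finset.mem_image_of_mem _ hz
    _ = ∏ i, ∑ m ∈ S.image (fun z => z i), q m := (Finset.prod_univ_sum _ _).symm
    _ ≤ ∏ _i : ι, ∑' m, q m := Finset.prod_le_prod
        (fun i _ => Finset.sum_nonneg fun m _ => hq0 m)
        (fun i _ => hq.sum_le_tsum _ fun m _ => hq0 m)
    _ = _ := by simp

theorem summable_int_pow_mul_exp_neg_sq (k : ℕ) {b : ℝ} (hb : 0 < b) :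
    Summable fun m : ℤ => (2 + |(m : ℝ)|) ^ k * Real.exp (-(b * (m : ℝ) ^ 2)) := by
  have hnat : Summable fun n : ℕ => (2 + |(n : ℝ)|) ^ k * Real.exp (-(b * (n : ℝ) ^ 2)) := by
    have h1 := ((summable_nat_add_iff 2).2 (Real.summable_pow_mul_exp_neg_nat_mul k hb)).mul_left
      (Real.exp (b * 2))
    refine Summable.of_nonneg_of_le (fun n => by positivity) (fun n => ?_) h1
    -- `n ≤ n²` reduces Gaussian decay to geometric decay; the shift by 2 turns `2 + n` into the
    -- summation index.
    have h2 : (n : ℝ) ≤ (n : ℝ) ^ 2 := by exact_mod_cast Nat.le_self_pow two_ne_zero n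
    have h3 : Real.exp (-(b * (n : ℝ) ^ 2)) ≤ Real.exp (b * 2) * Real.exp (-b * ((n + 2 : ℕ) : ℝ)) := by
      rw [← Real.exp_add, Real.exp_le_exp]
      push_cast
      nlinarith
    calc (2 + |(n : ℝ)|) ^ k * Real.exp (-(b * (n : ℝ) ^ 2))
        ≤ (2 + |(n : ℝ)|) ^ k * (Real.exp (b * 2) * Real.exp (-b * ((n + 2 : ℕ) : ℝ))) := by gcongr
      _ = _ := by
        rw [abs_of_nonneg (Nat.cast_nonneg n)]
        push_cast
        ring
  exact Summable.of_nat_of_neg (by simpa using hnat) (by simpa using hnat)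

theorem sum_le_prod_one_add {ι : Type*} (S : Finset ι) {a : ι → ℝ} (ha : ∀ i, 0 ≤ a i) :
    ∑ i ∈ S, a i ≤ ∏ i ∈ S, (1 + a i) := by
  classical
  suffices h : 1 + ∑ i ∈ S, a i ≤ ∏ i ∈ S, (1 + a i) by linarith
  induction S using Finset.induction_on with
  | empty => simp
  | insert i S hi ih =>
    rw [Finset.sum_insert hi, Finset.prod_insert hi]
    nlinarith [ha i, mul_nonneg (ha i) (Finset.sum_nonneg fun j (_ : j ∈ S) => ha j)]

/-- The lattice point `r • z` of `ℝ^d`. -/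
def latticePoint {d : ℕ} (r : ℝ) (z : Fin d → ℤ) : EuclideanSpace ℝ (Fin d) :=
  r • WithLp.toLp 2 (fun i => (z i : ℝ))

theorem latticePoint_apply {d : ℕ} (r : ℝ) (z : Fin d → ℤ) (i : Fin d) :
    latticePoint r z i = r * z i := by simp [latticePoint]

theorem exists_mem_cube_latticePoint {d : ℕ} {r : ℝ} (hr : 0 < r) (x : EuclideanSpace ℝ (Fin d)) :
    ∃ z : Fin d → ℤ, x ∈ cube (latticePoint r z) r := by
  refine ⟨fun i => ⌊x i / r⌋, fun i => ?_⟩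
  have h1 := Int.floor_le (x i / r)
  have h2 := (Int.lt_floor_add_one (x i / r)).le
  rw [le_div_iff₀ hr] at h1
  rw [div_le_iff₀ hr] at h2
  rw [latticePoint_apply, abs_le]
  constructor <;> nlinarith

/-- The sum over coordinates is weakened to a product so that the entropy series over `z`
factorizes. -/
theorem norm_le_of_mem_cube {d : ℕ} {r : ℝ} (hr : 0 < r) {x : EuclideanSpace ℝ (Fin d)}
    {z : Fin d → ℤ} (hx : x ∈ cube (latticePoint r z) r) :
    ‖x‖ ≤ r * ∏ i, (2 + |(z i : ℝ)|) := by
  have hsum : x = ∑ i, x i • EuclideanSpace.single i (1 : ℝ) := by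
    ext j
    simp [Finset.sum_apply, Pi.single_apply]
  calc ‖x‖ ≤ ∑ i, ‖x i • EuclideanSpace.single i (1 : ℝ)‖ := by
        conv_lhs => rw [hsum]
        exact norm_sum_le _ _
    _ ≤ ∑ i, r * (1 + |(z i : ℝ)|) := by
        refine Finset.sum_le_sum fun i _ => ?_
        have h1 := hx i
        rw [latticePoint_apply] at h1
        have h2 := abs_sub_abs_le_abs_sub (x i) (r * z i)
        rw [abs_mul, abs_of_pos hr] at h2
        simp only [norm_smul, Real.norm_eq_abs, PiLp.norm_single, norm_one, mul_one]
        linarith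
    _ ≤ r * ∏ i, (2 + |(z i : ℝ)|) := by
        rw [← Finset.mul_sum]
        refine mul_le_mul_of_nonneg_left ?_ hr.le
        refine (sum_le_prod_one_add _ fun i => by positivity).trans (le_of_eq ?_)
        exact Finset.prod_congr rfl fun i _ => by ring

/-- From `(r z)² ≤ 2 x² + 2 (r z - x)²` in each coordinate. The left side is the exponent of the
weight given to the cube at `r z`. -/
theorem le_norm_sq_of_mem_cube {d : ℕ} (hd : 1 ≤ d) {r : ℝ} (hr : 0 < r)
    {x : EuclideanSpace ℝ (Fin d)} {z : Fin d → ℤ} (hx : x ∈ cube (latticePoint r z) r) :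
    ∑ i, (z i : ℝ) ^ 2 / (8 * d) - 1 / 4 ≤ ‖x‖ ^ 2 / (4 * d * r ^ 2) := by
  have hd0 : (0 : ℝ) < d := by positivity
  have h1 : ∀ i, r ^ 2 * ((z i : ℝ) ^ 2 / 2 - 1) ≤ x i ^ 2 := by
    intro i
    have h := abs_le.1 (hx i)
    rw [latticePoint_apply] at h
    nlinarith [sq_nonneg (2 * x i - r * z i)]
  have h2 : ∑ i, r ^ 2 * ((z i : ℝ) ^ 2 / 2 - 1) ≤ ‖x‖ ^ 2 := by
    rw [EuclideanSpace.real_norm_sq_eq]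
    exact Finset.sum_le_sum fun i _ => h1 i
  rw [le_div_iff₀ (by positivity)]
  refine le_trans (le_of_eq ?_) h2
  rw [← Finset.mul_sum, Finset.sum_sub_distrib, ← Finset.sum_div, ← Finset.sum_div]
  simp
  field_simp
  ring

theorem exists_coloring_classF (d s : ℕ) (hd : 1 ≤ d) (hs : 1 ≤ s) (K : ℝ) (hK : 0 < K) :
    ∃ C : ℝ, 0 < C ∧ ∀ σ η : ℝ, 1 ≤ σ → 0 < η → ∃ m : ℕ, 0 < m ∧
      HasColoring m (classF d s K)
        (fun f g => ∀ x, |f x - g x| ≤ η * Real.exp (‖x‖ ^ 2 / (4 * d * σ ^ 2))) ∧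
      Real.log m ≤ C * η ^ (-((d : ℝ) / s)) * σ ^ (2 * d) := by
  obtain ⟨A, hA, hcol⟩ := exists_coloring_cube_le d s hd hs
  have hB : 2 ≤ scaleConst d s := by
    have h1 : (1 : ℝ) ≤ 2 ^ s := one_le_pow₀ one_le_two
    have h2 : (0 : ℝ) ≤ (d : ℝ) ^ s := by positivity
    unfold scaleConst
    nlinarith
  have hs0 : (0 : ℝ) < s := by exact_mod_cast hs
  have hd0 : (0 : ℝ) < d := by exact_mod_cast hd
  set p : ℝ := (d : ℝ) / s with hp
  have hp0 : 0 < p := by positivity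
  -- One coordinate's factor of the entropy of a cube: raising to the power `d / s` turns `(2 +
  -- |m|)^s` into `(2 + |m|)^d` and the rate `1 / (8d)` into `1 / (8s)`.
  set q : ℤ → ℝ := fun m => (2 + |(m : ℝ)|) ^ d * Real.exp (-(1 / (8 * s) * (m : ℝ) ^ 2)) with hq
  have hq0 : ∀ m, 0 ≤ q m := fun m => by positivity
  have hqs : Summable q := summable_int_pow_mul_exp_neg_sq d (by positivity)
  set T : ℝ := (∑' m, q m) ^ d with hT
  have hT0 : 0 ≤ T := pow_nonneg (tsum_nonneg hq0) d
  set D₀ : ℝ := 2 * K * Real.exp (1 / 4) with hD₀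
  have hD₀0 : 0 < D₀ := by positivity
  refine ⟨A * D₀ ^ p * T + 1, by positivity, fun σ η hσ hη => ?_⟩
  have hσ0 : 0 < σ := by linarith
  set M : (Fin d → ℤ) → ℝ := fun z => 2 * K * (σ * ∏ i, (2 + |(z i : ℝ)|)) ^ s with hM
  set W : (Fin d → ℤ) → ℝ := fun z => Real.exp (∑ i, (z i : ℝ) ^ 2 / (8 * d) - 1 / 4) with hW
  have hprod1 : ∀ z : Fin d → ℤ, 1 ≤ ∏ i, (2 + |(z i : ℝ)|) := fun z =>
    Finset.prod_induction (fun i => 2 + |(z i : ℝ)|) (1 ≤ ·)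
      (fun _ _ => one_le_mul_of_one_le_of_one_le) le_rfl
      fun i _ => by linarith [abs_nonneg (z i : ℝ)]
  have hM0 : ∀ z, 0 < M z := fun z => by
    have := hprod1 z
    positivity
  have hMle : ∀ z, ∀ x ∈ cube (latticePoint σ z) σ, K * (1 + ‖x‖ ^ s) ≤ M z := by
    intro z x hx
    have h1 := pow_le_pow_left₀ (norm_nonneg x) (norm_le_of_mem_cube hσ0 hx) s
    have h2 : 1 ≤ (σ * ∏ i, (2 + |(z i : ℝ)|)) ^ s :=
      one_le_pow₀ (one_le_mul_of_one_le_of_one_le hσ (hprod1 z))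
    simp only [hM]
    nlinarith
  have hpow : ∀ z, (M z * σ ^ s / (η * W z)) ^ p
      = D₀ ^ p * η ^ (-p) * σ ^ (2 * d) * ∏ i, q (z i) := by
    intro z
    have e1 : M z * σ ^ s / (η * W z) = D₀ * η⁻¹ * σ ^ (2 * s) *
        ∏ i, ((2 + |(z i : ℝ)|) ^ s * Real.exp (-((z i : ℝ) ^ 2 / (8 * d)))) := by
      simp only [hM, hW, hD₀]
      rw [Finset.prod_mul_distrib, ← Real.exp_sum, Finset.sum_neg_distrib, Real.exp_neg,
        Real.exp_sub, mul_pow, Finset.prod_pow]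
      field_simp
      ring
    have e2 : (σ ^ (2 * s)) ^ p = σ ^ (2 * d) := by
      rw [← Real.rpow_natCast, ← Real.rpow_mul hσ0.le, ← Real.rpow_natCast]
      congr 1
      rw [hp]
      push_cast
      field_simp
    have e3 : ∀ m : ℤ, ((2 + |(m : ℝ)|) ^ s * Real.exp (-((m : ℝ) ^ 2 / (8 * d)))) ^ p = q m := by
      intro m
      rw [Real.mul_rpow (by positivity) (by positivity), ← Real.exp_mul, ← Real.rpow_natCast,
        ← Real.rpow_mul (by positivity)]
      simp only [hq]
      rw [← Real.rpow_natCast (2 + |(m : ℝ)|) d]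
      congr 2
      · rw [hp]; field_simp
      · rw [hp]; field_simp
    rw [e1, Real.mul_rpow (by positivity) (Finset.prod_nonneg fun i _ => by positivity),
      Real.mul_rpow (by positivity) (by positivity), Real.mul_rpow (by positivity) (by positivity),
      e2, Real.inv_rpow hη.le, ← Real.rpow_neg hη.le,
      ← Real.finsetProd_rpow _ _ (fun i _ => by positivity)]
    simp only [e3]
  have hsite : ∀ z, ∃ m : ℕ, 0 < m ∧ HasColoring m (classF d s K)
      (fun f g => ∀ x ∈ cube (latticePoint σ z) σ, |f x - g x| ≤ η * W z) ∧
      Real.log m ≤ A * (M z * σ ^ s / (η * W z)) ^ p ∧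
      (scaleConst d s * (M z * σ ^ s) ≤ η * W z → m = 1) := by
    intro z
    refine hcol (M z) σ (η * W z) (latticePoint σ z) (classF d s K) (hM0 z) hσ0 (by positivity)
      ?_ ?_
    · exact fun f hf => ⟨hf.1, fun i y hy => (hf.2.2 s le_rfl i y).trans (hMle z y hy)⟩
    -- The starting diameter is `2 M z`, from the derivative bound of order 0; it suffices since
    -- `scaleConst ≥ 2` and `σ ≥ 1`.
    · intro f hf g hg x hx
      have h1 : |f x| ≤ M z := by
        simpa [partialDeriv] using (hf.2.2 0 (Nat.zero_le s) Fin.elim0 x).trans (hMle z x hx)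
      have h2 : |g x| ≤ M z := by
        simpa [partialDeriv] using (hg.2.2 0 (Nat.zero_le s) Fin.elim0 x).trans (hMle z x hx)
      have h3 : M z ≤ M z * σ ^ s := le_mul_of_one_le_right (hM0 z).le (one_le_pow₀ hσ)
      have h4 := abs_sub (f x) (g x)
      have h5 := hM0 z
      nlinarith
  choose m hm0 hmcol hmlog hm1 using hsite
  -- Outside this set the whole class is already within tolerance, so one colour is enough; a
  -- summable series has only finitely many terms above a threshold.
  have hfin : {z | 1 < scaleConst d s * (M z * σ ^ s / (η * W z))}.Finite := by
    have hsum : Summable fun z : Fin d → ℤ => (M z * σ ^ s / (η * W z)) ^ p := by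
      simp only [hpow]
      refine Summable.mul_left _ (summable_of_sum_le
        (fun z => Finset.prod_nonneg fun i _ => hq0 _) (c := T) fun S => ?_)
      simpa using sum_prod_le_tsum_pow hq0 hqs S
    have hev := hsum.tendsto_cofinite_zero.eventually_lt_const
      (show 0 < (1 / scaleConst d s) ^ p by positivity)
    refine (Filter.eventually_cofinite.1 hev).subset fun z hz => ?_
    simp only [Set.mem_ofPred_eq] at hz ⊢
    rw [not_lt]
    refine Real.rpow_le_rpow (by positivity) ?_ hp0.le
    rw [div_le_iff₀ (by positivity)]
    linarith
  refine ⟨∏ z ∈ hfin.toFinset, m z, Finset.prod_pos fun z _ => hm0 z,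
    (HasColoring.prod fun z _ => hmcol z).mono le_rfl ?_, ?_⟩
  · intro f hf g hg h x
    obtain ⟨z, hz⟩ := exists_mem_cube_latticePoint hσ0 x
    have hbd : |f x - g x| ≤ η * W z := by
      by_cases hzS : z ∈ hfin.toFinset
      · exact h z hzS x hz
      · have h1 : m z = 1 := hm1 z (by
          rw [Set.Finite.mem_toFinset, Set.mem_ofPred_eq, not_lt, ← mul_div_assoc,
            div_le_one (by positivity)] at hzS
          exact hzS)
        obtain ⟨φ, hφ⟩ := hmcol z
        refine hφ f hf g hg (Fin.ext ?_) x hz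
        have := (φ f).2
        have := (φ g).2
        omega
    refine hbd.trans (mul_le_mul_of_nonneg_left ?_ hη.le)
    exact Real.exp_le_exp.2 (le_norm_sq_of_mem_cube hd hσ0 hz)
  · rw [Nat.cast_prod, Real.log_prod fun z _ => by exact_mod_cast (hm0 z).ne']
    have hE : 0 ≤ η ^ (-p) * σ ^ (2 * d) := by positivity
    calc ∑ z ∈ hfin.toFinset, Real.log (m z)
        ≤ ∑ z ∈ hfin.toFinset, A * (D₀ ^ p * η ^ (-p) * σ ^ (2 * d) * ∏ i, q (z i)) :=
          Finset.sum_le_sum fun z _ => by rw [← hpow]; exact hmlog z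
      _ = A * (D₀ ^ p * η ^ (-p) * σ ^ (2 * d)) * ∑ z ∈ hfin.toFinset, ∏ i, q (z i) := by
          rw [Finset.mul_sum]
          exact Finset.sum_congr rfl fun z _ => by ring
      _ ≤ A * (D₀ ^ p * η ^ (-p) * σ ^ (2 * d)) * T := by
          gcongr
          simpa using sum_prod_le_tsum_pow hq0 hqs hfin.toFinset
      _ ≤ _ := by nlinarith

/-! ### From colourings to the empirical seminorm -/

/-- One member of each nonempty colour class serves as a centre, so the centres lie in `A` and the
radius is not doubled. -/
theorem coveringNumber_le_of_hasColoring {X : Type*} [PseudoEMetricSpace X] {A : Set X} {ε : ℝ≥0}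
    {m : ℕ} (h : HasColoring m A (fun f g => edist f g ≤ ε)) : Metric.coveringNumber ε A ≤ m := by
  classical
  obtain ⟨φ, hφ⟩ := h
  have hex : ∀ a : {a : Fin m // ∃ f ∈ A, φ f = a}, ∃ f ∈ A, φ f = a := fun a => a.2
  choose r hrA hr using hex
  have hsub : Set.range r ⊆ A := by
    rintro _ ⟨a, rfl⟩
    exact hrA a
  have hcov : Metric.IsCover ε A (Set.range r) := fun f hf =>
    ⟨r ⟨φ f, f, hf, rfl⟩, Set.mem_range_self _, hφ f hf _ (hrA _) (hr ⟨φ f, f, hf, rfl⟩).symm⟩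
  refine (hcov.coveringNumber_le_encard hsub).trans ?_
  rw [← Set.image_univ]
  refine (Set.encard_image_le _ _).trans ?_
  rw [Set.encard_univ, ENat.card_eq_coe_natCard, Nat.card_eq_fintype_card]
  exact_mod_cast (Fintype.card_subtype_le _).trans (by simp)

theorem empL2Norm_sq_le {E : Type*} {n : ℕ} (x : Fin n → E) {f : E → ℝ} {b : E → ℝ}
    (h : ∀ i, f (x i) ^ 2 ≤ b (x i)) : empL2Norm x f ^ 2 ≤ (1 / (n : ℝ)) * ∑ i, b (x i) := by
  rw [empL2Norm, Real.sq_sqrt (by positivity)]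
  gcongr with i
  exact h i

theorem empCoveringNumber_classF_le (d s : ℕ) (hd : 1 ≤ d) (hs : 1 ≤ s) (K : ℝ) (hK : 0 < K) :
    ∃ C : ℝ, 0 < C ∧ ∀ (σ : ℝ) (n : ℕ) (x : Fin n → EuclideanSpace ℝ (Fin d)) (L : ℝ) (ε : ℝ≥0),
      1 ≤ σ → 0 < L → (1 / (n : ℝ)) * ∑ i, Real.exp (‖x i‖ ^ 2 / (2 * d * σ ^ 2)) ≤ L → 0 < ε →
      empCoveringNumber x ε (classF d s K) ≠ ⊤ ∧
        Real.log ((empCoveringNumber x ε (classF d s K)).toNat : ℝ) ≤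
          C * L ^ ((d : ℝ) / (2 * (s : ℝ))) * (ε : ℝ) ^ (-((d : ℝ) / (s : ℝ))) * σ ^ (2 * d) := by
  obtain ⟨C, hC, hcol⟩ := exists_coloring_classF d s hd hs K hK
  refine ⟨C, hC, fun σ n x L ε hσ hL hx hε => ?_⟩
  have hε' : (0 : ℝ) < ε := hε
  obtain ⟨m, hm0, hm, hlog⟩ := hcol σ (ε / √L) hσ (by positivity)
  have hle : empCoveringNumber x ε (classF d s K) ≤ m := by
    refine @coveringNumber_le_of_hasColoring _ (empL2PseudoMetric x).toPseudoEMetricSpace _ _ _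
      (hm.mono le_rfl fun f _ g _ h => ?_)
    have hdist : empL2Norm x (f - g) ≤ ε := by
      refine le_of_sq_le_sq ?_ hε'.le
      refine (empL2Norm_sq_le x (b := fun y =>
        ε ^ 2 / L * Real.exp (‖y‖ ^ 2 / (2 * d * σ ^ 2))) fun i => ?_).trans ?_
      · have h1 := pow_le_pow_left₀ (abs_nonneg _) (h (x i)) 2
        rw [sq_abs, mul_pow, div_pow, Real.sq_sqrt hL.le, ← Real.exp_nat_mul] at h1
        refine h1.trans (le_of_eq ?_)
        congr 2
        push_cast
        ring
      · rw [← Finset.mul_sum]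
        calc (1 / (n : ℝ)) * ((ε : ℝ) ^ 2 / L * ∑ i, Real.exp (‖x i‖ ^ 2 / (2 * d * σ ^ 2)))
            = (ε : ℝ) ^ 2 / L * ((1 / (n : ℝ)) * ∑ i, Real.exp (‖x i‖ ^ 2 / (2 * d * σ ^ 2))) := by
              ring
          _ ≤ (ε : ℝ) ^ 2 / L * L := by gcongr
          _ = (ε : ℝ) ^ 2 := by field_simp
    let := empL2PseudoMetric x
    rw [edist_dist, ENNReal.ofReal_le_iff_le_toReal ENNReal.coe_ne_top]
    exact hdist
  have hne : empCoveringNumber x ε (classF d s K) ≠ ⊤ :=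
    ne_top_of_le_ne_top (ENat.natCast_ne_top m) hle
  refine ⟨hne, ?_⟩
  have hnat : (empCoveringNumber x ε (classF d s K)).toNat ≤ m := ENat.toNat_le_of_le_natCast hle
  have h1 : Real.log ((empCoveringNumber x ε (classF d s K)).toNat : ℝ) ≤ Real.log m := by
    rcases Nat.eq_zero_or_pos (empCoveringNumber x ε (classF d s K)).toNat with h0 | h0
    · rw [h0, Nat.cast_zero, Real.log_zero]
      exact Real.log_natCast_nonneg m
    · exact Real.log_le_log (by exact_mod_cast h0) (by exact_mod_cast hnat)
  refine h1.trans (hlog.trans (le_of_eq ?_))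
  have h2 : (√L) ^ ((d : ℝ) / s) = L ^ ((d : ℝ) / (2 * s)) := by
    rw [Real.sqrt_eq_rpow, ← Real.rpow_mul hL.le]
    congr 1
    ring
  rw [Real.div_rpow hε'.le (Real.sqrt_nonneg L), Real.rpow_neg (Real.sqrt_nonneg L), div_inv_eq_mul,
    h2]
  ring

theorem empL2Norm_classF_sq_le {d s : ℕ} (hd : 1 ≤ d) {K : ℝ} {σ L : ℝ} (hσ : 0 < σ)
    {n : ℕ} (hn : 1 ≤ n) (x : Fin n → EuclideanSpace ℝ (Fin d))
    (hx : (1 / (n : ℝ)) * ∑ i, Real.exp (‖x i‖ ^ 2 / (2 * d * σ ^ 2)) ≤ L)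
    {f : EuclideanSpace ℝ (Fin d) → ℝ} (hf : f ∈ classF d s K) :
    empL2Norm x f ^ 2 ≤ 16 * K ^ 2 * d ^ 2 * (1 + L * σ ^ 4) := by
  have hd1 : (1 : ℝ) ≤ d := by exact_mod_cast hd
  have hn1 : (0 : ℝ) < n := by exact_mod_cast hn
  refine (empL2Norm_sq_le x (b := fun y =>
    2 * K ^ 2 + 16 * K ^ 2 * d ^ 2 * σ ^ 4 * Real.exp (‖y‖ ^ 2 / (2 * d * σ ^ 2))) fun i => ?_).trans ?_
  · have h1 := pow_le_pow_left₀ (abs_nonneg _) (hf.2.1 (x i)) 2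
    rw [sq_abs] at h1
    set u : ℝ := ‖x i‖ ^ 2 / (2 * d * σ ^ 2) with hu
    have hu0 : 0 ≤ u := by positivity
    have h2 : ‖x i‖ ^ 2 = u * (2 * d * σ ^ 2) := by rw [hu]; field_simp
    have h3 := Real.quadratic_le_exp_of_nonneg hu0
    rw [h2] at h1
    have h4 : u ^ 2 ≤ 2 * Real.exp u := by nlinarith
    -- Here `(1 + a)² ≤ 2 + 2a²` with `a = 2dσ²u`.
    calc f (x i) ^ 2 ≤ (K * (1 + u * (2 * d * σ ^ 2))) ^ 2 := h1
      _ ≤ 2 * K ^ 2 + 8 * K ^ 2 * d ^ 2 * σ ^ 4 * u ^ 2 := by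
          nlinarith [mul_nonneg (sq_nonneg K) (sq_nonneg (1 - u * (2 * d * σ ^ 2)))]
      _ ≤ 2 * K ^ 2 + 8 * K ^ 2 * d ^ 2 * σ ^ 4 * (2 * Real.exp u) := by gcongr
      _ = _ := by ring
  · have h5 : 2 * K ^ 2 ≤ 16 * K ^ 2 * d ^ 2 := by
      nlinarith [mul_nonneg (sq_nonneg K) (by nlinarith : (0 : ℝ) ≤ (d : ℝ) ^ 2 - 1), sq_nonneg K]
    rw [Finset.sum_add_distrib, Finset.sum_const, Finset.card_univ, Fintype.card_fin, nsmul_eq_mul,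
      ← Finset.mul_sum (a := 16 * K ^ 2 * d ^ 2 * σ ^ 4)]
    calc (1 / (n : ℝ)) * (n * (2 * K ^ 2) + 16 * K ^ 2 * d ^ 2 * σ ^ 4
          * ∑ i, Real.exp (‖x i‖ ^ 2 / (2 * d * σ ^ 2)))
        = 2 * K ^ 2 + 16 * K ^ 2 * d ^ 2 * σ ^ 4
          * ((1 / (n : ℝ)) * ∑ i, Real.exp (‖x i‖ ^ 2 / (2 * d * σ ^ 2))) := by field_simp
      _ ≤ 16 * K ^ 2 * d ^ 2 + 16 * K ^ 2 * d ^ 2 * σ ^ 4 * L := by gcongr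
      _ = _ := by ring

/-! ### The subgaussian hypothesis and the choice of `L` -/

theorem IsSubgaussian.lintegral_exp_le {d : ℕ} (hd : 1 ≤ d)
    {P : Measure (EuclideanSpace ℝ (Fin d))} {σ : ℝ≥0} (hσ : 0 < σ) (h : IsSubgaussian P σ) :
    ∫⁻ x, ENNReal.ofReal (Real.exp (‖x‖ ^ 2 / (2 * d * (σ : ℝ) ^ 2))) ∂P ≤ 2 := by
  refine le_trans (le_of_eq (lintegral_congr fun x => ?_)) h
  have hpos : (0 : ℝ) < 2 * d * (σ : ℝ) ^ 2 := by
    have : (0 : ℝ) < σ := hσ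
    positivity
  have h1 : (‖x‖ₑ ^ 2 / (2 * (d : ℝ≥0∞) * (σ : ℝ≥0∞) ^ 2) : ℝ≥0∞)
      = ENNReal.ofReal (‖x‖ ^ 2 / (2 * d * (σ : ℝ) ^ 2)) := by
    rw [ENNReal.ofReal_div_of_pos hpos, ENNReal.ofReal_pow (norm_nonneg x), ofReal_norm,
      ENNReal.ofReal_mul (by positivity), ENNReal.ofReal_mul (by positivity),
      ENNReal.ofReal_pow (by positivity)]
    simp
  rw [h1, EReal.coe_ennreal_ofReal, max_eq_left (by positivity), EReal.exp_coe]

/-- Off the origin the integrand is `exp ∞ = ∞`, yet its integral is finite. -/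
theorem IsSubgaussian.ae_eq_zero {d : ℕ} {P : Measure (EuclideanSpace ℝ (Fin d))}
    (h : IsSubgaussian P 0) : ∀ᵐ x ∂P, x = 0 := by
  have hmeas : Measurable fun x : EuclideanSpace ℝ (Fin d) =>
      EReal.exp ((‖x‖ₑ ^ 2 / (2 * (d : ℝ≥0∞) * ((0 : ℝ≥0) : ℝ≥0∞) ^ 2) : ℝ≥0∞) : EReal) := by
    fun_prop
  filter_upwards [ae_lt_top hmeas (h.trans_lt (by simp)).ne] with x hx
  by_contra hx0
  simp [ENNReal.div_zero, hx0] at hx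

theorem lintegral_pi_average_le {E : Type*} [MeasurableSpace E] (P : Measure E)
    [IsProbabilityMeasure P] {g : E → ℝ} (hg : Measurable g) (hg0 : ∀ x, 0 ≤ g x) {B : ℝ≥0∞}
    (hB : ∫⁻ x, ENNReal.ofReal (g x) ∂P ≤ B) (n : ℕ) :
    ∫⁻ x, ENNReal.ofReal ((1 / (n : ℝ)) * ∑ i, g (x i)) ∂(Measure.pi fun _ : Fin n => P) ≤ B := by
  have hgm : Measurable fun x => ENNReal.ofReal (g x) := hg.ennreal_ofReal
  have h1 : ∀ x : Fin n → E, ENNReal.ofReal ((1 / (n : ℝ)) * ∑ i, g (x i))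
      = ENNReal.ofReal (1 / (n : ℝ)) * ∑ i, ENNReal.ofReal (g (x i)) := fun x => by
    rw [ENNReal.ofReal_mul (by positivity), ENNReal.ofReal_sum_of_nonneg fun i _ => hg0 _]
  simp only [h1]
  rw [lintegral_const_mul _ (by fun_prop), lintegral_finsetSum _ (by fun_prop)]
  have h2 : ∀ i : Fin n, ∫⁻ x, ENNReal.ofReal (g (x i)) ∂(Measure.pi fun _ : Fin n => P) ≤ B :=
    fun i => ((measurePreserving_eval (fun _ : Fin n => P) i).lintegral_comp hgm).trans_le hB
  calc _ ≤ ENNReal.ofReal (1 / (n : ℝ)) * ∑ _i : Fin n, B := by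
        gcongr with i
        exact h2 i
    _ = ENNReal.ofReal (1 / (n : ℝ) * n) * B := by
        rw [ENNReal.ofReal_mul (by positivity)]
        simp [mul_assoc]
    _ ≤ 1 * B := by
        gcongr
        rw [← ENNReal.ofReal_one]
        exact ENNReal.ofReal_le_ofReal (by rw [one_div]; exact inv_mul_le_one)
    _ = B := one_mul B

theorem proposition7 (d : ℕ) (hd : 1 ≤ d) (s : ℕ) (hs : s = ⌈(d : ℝ) / 2⌉₊ + 1)
    (K : ℝ) (hK : 0 < K) :
    ∃ C : ℝ, 0 < C ∧
      ∀ (P : Measure (EuclideanSpace ℝ (Fin d))) [IsProbabilityMeasure P] (σ : ℝ≥0),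
        IsSubgaussian P σ →
        ∀ n : ℕ, 1 ≤ n →
        ∃ L : (Fin n → EuclideanSpace ℝ (Fin d)) → ℝ≥0, Measurable L ∧
          ∫⁻ x, (L x : ℝ≥0∞) ∂(Measure.pi (fun _ : Fin n => P)) ≤ 2 ∧
          ∀ᵐ x ∂(Measure.pi (fun _ : Fin n => P)),
            (∀ ε : ℝ≥0, 0 < ε →
              empCoveringNumber x ε (classF d s K) ≠ ⊤ ∧
              Real.log ((empCoveringNumber x ε (classF d s K)).toNat : ℝ) ≤
                C * (L x : ℝ) ^ ((d : ℝ) / (2 * (s : ℝ))) * (ε : ℝ) ^ (-((d : ℝ) / (s : ℝ))) *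
                  (1 + (σ : ℝ) ^ (2 * d))) ∧
            (∀ f ∈ classF d s K, empL2Norm x f ^ 2 ≤ C * (1 + (L x : ℝ) * (σ : ℝ) ^ 4)) := by
  have hs1 : 1 ≤ s := by omega
  have hd1 : (1 : ℝ) ≤ d := by exact_mod_cast hd
  obtain ⟨C, hC, hcov⟩ := empCoveringNumber_classF_le d s hd hs1 K hK
  refine ⟨C + 16 * K ^ 2 * d ^ 2, by positivity, fun P _ σ hP n hn => ?_⟩
  have hn0 : (0 : ℝ) < n := by exact_mod_cast hn
  have hentropy : ∀ (x : Fin n → EuclideanSpace ℝ (Fin d)) (l : ℝ≥0), 0 < l →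
      (1 / (n : ℝ)) * ∑ i, Real.exp (‖x i‖ ^ 2 / (2 * d * (max σ 1 : ℝ) ^ 2)) ≤ l →
      ∀ ε : ℝ≥0, 0 < ε → empCoveringNumber x ε (classF d s K) ≠ ⊤ ∧
        Real.log ((empCoveringNumber x ε (classF d s K)).toNat : ℝ) ≤
          (C + 16 * K ^ 2 * d ^ 2) * (l : ℝ) ^ ((d : ℝ) / (2 * (s : ℝ))) *
            (ε : ℝ) ^ (-((d : ℝ) / (s : ℝ))) * (1 + (σ : ℝ) ^ (2 * d)) := by
    intro x l hl hxl ε hε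
    obtain ⟨h1, h2⟩ := hcov (max σ 1) n x l ε (le_max_right _ _) hl hxl hε
    refine ⟨h1, h2.trans ?_⟩
    have h3 : (max σ 1 : ℝ) ^ (2 * d) ≤ 1 + (σ : ℝ) ^ (2 * d) := by
      rcases max_cases (σ : ℝ) 1 with ⟨h, -⟩ | ⟨h, -⟩ <;> rw [h]
      · linarith
      · simp
    gcongr
    have : 0 ≤ 16 * K ^ 2 * (d : ℝ) ^ 2 := by positivity
    linarith
  rcases eq_or_lt_of_le (show 0 ≤ σ from zero_le) with rfl | hσ
  -- For `σ = 0` every sample point is almost surely the origin, where the exponential is 1, so `L =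
  -- 1` works.
  · refine ⟨fun _ => 1, measurable_const, by simp, ?_⟩
    have hae : ∀ᵐ x ∂(Measure.pi fun _ : Fin n => P), ∀ i, x i = 0 :=
      ae_all_iff.2 fun i => (measurePreserving_eval (fun _ : Fin n => P) i).quasiMeasurePreserving.ae
        hP.ae_eq_zero
    filter_upwards [hae] with x hx
    refine ⟨hentropy x 1 one_pos ?_, fun f hf => ?_⟩
    · simp [hx, hn0.ne']
    · refine (empL2Norm_sq_le x (b := fun _ => K ^ 2) fun i => ?_).trans ?_
      · have h := hf.2.1 (x i)
        rw [hx i] at h ⊢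
        exact sq_le_sq' (by simpa using (abs_le.1 h).1) (by simpa using (abs_le.1 h).2)
      · simp only [Finset.sum_const, Finset.card_univ, Fintype.card_fin, nsmul_eq_mul]
        rw [one_div, inv_mul_cancel_left₀ hn0.ne']
        simp
        nlinarith [mul_nonneg (sq_nonneg K) (by nlinarith : (0 : ℝ) ≤ (d : ℝ) ^ 2 - 1), sq_nonneg K]
  · have hσ' : (0 : ℝ) < σ := hσ
    set A : (Fin n → EuclideanSpace ℝ (Fin d)) → ℝ := fun x =>
      (1 / (n : ℝ)) * ∑ i, Real.exp (‖x i‖ ^ 2 / (2 * d * (σ : ℝ) ^ 2)) with hA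
    have hApos : ∀ x, 0 < A x := fun x => by
      have : Nonempty (Fin n) := ⟨⟨0, hn⟩⟩
      have : 0 < ∑ i, Real.exp (‖x i‖ ^ 2 / (2 * d * (σ : ℝ) ^ 2)) :=
        Finset.sum_pos (fun i _ => Real.exp_pos _) Finset.univ_nonempty
      simp only [hA]
      positivity
    have hAcoe : ∀ x, ((A x).toNNReal : ℝ) = A x := fun x => Real.coe_toNNReal _ (hApos x).le
    refine ⟨fun x => (A x).toNNReal, ?_, ?_, Filter.Eventually.of_forall fun x => ⟨?_, ?_⟩⟩
    · have : Measurable A := by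
        simp only [hA]
        fun_prop
      exact this.real_toNNReal
    · exact lintegral_pi_average_le P (g := fun y => Real.exp (‖y‖ ^ 2 / (2 * d * (σ : ℝ) ^ 2)))
        (by fun_prop) (fun _ => (Real.exp_pos _).le) (hP.lintegral_exp_le hd hσ) n
    -- Replacing `σ` by `max σ 1` only decreases the exponentials, so the same `L` dominates their
    -- mean.
    · refine hentropy x _ (Real.toNNReal_pos.2 (hApos x)) ?_
      rw [hAcoe]
      simp only [hA]
      gcongr
      exact le_max_left _ _
    · intro f hf
      rw [hAcoe]
      refine (empL2Norm_classF_sq_le hd hσ' hn x (L := A x) le_rfl hf).trans ?_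
      have := hApos x
      gcongr
      linarith
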